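/- Fix a nominal signature: a set of atom sorts $\nu$ and a set of data sorts $\delta$; sorts $\tau ::= \nu \mid \delta \mid \langle\nu\rangle\tau$; a set of atoms, each having an atom sort; a set of variables, each having an atom sort or a data sort; and function symbols $f$ with arities $\tau_1\times\cdots\times\tau_n\to\delta$, $n\ge 0$. Nominal terms are the well-sorted terms $t ::= f(t_1,\dots,t_n)\mid a\mid a.t\mid \pi\cdot X$, where a permutation $\pi$ is a finite list of swappings $(a\,b)$ of atoms of the same sort, $a.t$ has sort $\langle\nu\rangle\tau$ if $a:\nu$ and $t:\tau$, and $\pi\cdot X$ has the sort of $X$ (we write $X$ for $\pi\cdot X$ with $\pi$ empty). A permutation acts on all atoms of a term, including the binding ones, with $\pi\cdot(\pi'\cdot X)=(\pi\pi')\cdot X$. A substitution $\sigma$ is a finite sort-respecting assignment $[X_1\mapsto t_1,\dots,X_n\mapsto t_n]$ with distinct $X_i$ and ${\rm Dom}(\sigma)=\{X_1,\dots,X_n\}$ (pairs $X\mapsto X$ are allowed and count in the domain), and $\sigma(X)=X$ for $X\notin{\rm Dom}(\sigma)$; it extends to terms, possibly capturing atoms, with $\sigma(\pi\cdot X)=\pi\cdot\sigma(X)$.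 A freshness environment $\nabla$ is a finite list of constraints $a\,\#\,X$. The judgements $\nabla\vdash a\,\#\,t$ and $\nabla\vdash t\approx u$ are the least relations such that: - $\nabla\vdash a\,\#\,a'$ if $a\ne a'$; $\nabla\vdash a\,\#\,\pi\cdot X$ if $(\pi^{-1}\cdot a\,\#\,X)\in\nabla$; $\nabla\vdash a\,\#\,f(t_1,\dots,t_n)$ if $\nabla\vdash a\,\#\,t_i$ for all $i$; $\nabla\vdash a\,\#\,a.t$; and $\nabla\vdash a\,\#\,a'.t$ if $a\neq a'$ and $\nabla\vdash a\,\#\,t$; - $\nabla\vdash a\approx a$; $\nabla\vdash\pi\cdot X\approx\pi'\cdot X$ if $(a\,\#\,X)\in\nabla$ for all atoms $a$ with $\pi\cdot a\ne\pi'\cdot a$; $\nabla\vdash f(t_1,\dots,t_n)\approx f(t'_1,\dots,t'_n)$ if $\nabla\vdash t_i\approx t_i'$ for all $i$; $\nabla\vdash a.t\approx a.t'$ if $\nabla\vdash t\approx t'$; and $\nabla\vdash a.t\approx a'.t'$ if $a\ne a'$, $\nabla\vdash t\approx(a\,a')\cdot t'$ and $\nabla\vdash a\,\#\,t'$. A nominal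 unification problem $P$ is a finite set of equality equations $t\approx^? u$, with $t,u$ of the same sort, and freshness equations $a\,\#^?\,t$; ${\rm Vars}(P)$ is the set of variables occurring in it. A unifier of $P$ is a pair $\langle\nabla,\sigma\rangle$ with $\nabla\vdash\sigma(t)\approx\sigma(u)$ for every $t\approx^?u$ in $P$ and $\nabla\vdash a\,\#\,\sigma(t)$ for every $a\,\#^?\,t$ in $P$. We say that $\langle\nabla_1,\sigma_1\rangle$ is more general than $\langle\nabla_2,\sigma_2\rangle$ if there is a substitution $\sigma'$ such that $\nabla_2\vdash a\,\#\,\sigma'(X)$ for every $(a\,\#\,X)\in\nabla_1$, and $\nabla_2\vdash\sigma'(\sigma_1(X))\approx\sigma_2(X)$ for every $X\in{\rm Dom}(\sigma_1)\cup{\rm Dom}(\sigma_2)$. A unifier $c$ is most general in a class $U$ of unifiers of $P$ if $c\in U$ and, for every $c'\in U$ that is more general than $c$, also $c$ is more general than $c'$. **Corollary (most general nominal unifiers are unique).** Let $P$ be a nominal unification problem. If $\langle\nabla_1,\sigma_1\rangle$ and $\langle\nabla_2,\sigma_2\rangle$ are both most general in the class of all unifiers of $P$, then each of them is more general than the other.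 The same holds if both are most general in the class of those unifiers $\langle\nabla,\sigma\rangle$ of $P$ that satisfy ${\rm Dom}(\sigma)={\rm Vars}(P)$. -/

import Mathlib

universe u

namespace Nominal

/-- Sorts: `τ ::= ν | δ | ⟨ν⟩τ`, where `ν` ranges over atom sorts and `δ` over data sorts. -/
inductive NSort (A D : Type u) : Type u
  | atom (ν : A) : NSort A D
  | data (δ : D) : NSort A D
  | abs (ν : A) (τ : NSort A D) : NSort A D

/-- A nominal signature together with its sorted atoms and sorted variables.
Variables have an atom sort or a data sort.
A function symbol `f` has an arity `dom f 0 × ⋯ × dom f (n-1) → cod f`, with `n = arity f`. -/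
structure Signature where
  ASort : Type u
  DSort : Type u
  Atom : Type u
  atomSort : Atom → ASort
  Var : Type u
  varSort : Var → ASort ⊕ DSort
  Fn : Type u
  arity : Fn → ℕ
  dom : (f : Fn) → Fin (arity f) → NSort ASort DSort
  cod : Fn → DSort

variable {S : Signature.{u}}

/-- The sort of a variable, as an element of the grammar of sorts. -/
def Signature.sortOfVar (S : Signature.{u}) (X : S.Var) : NSort S.ASort S.DSort :=
  Sum.elim NSort.atom NSort.data (S.varSort X)

/-- A permutation is a finite list of swappings. -/
abbrev Perm (S : Signature.{u}) : Type u := List (S.Atom × S.Atom)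

/-- Swappings only exchange atoms of the same sort. -/
def Perm.WellSorted (π : Perm S) : Prop := ∀ p ∈ π, S.atomSort p.1 = S.atomSort p.2

open Classical in
/-- The effect of the swapping `(a b)` on an atom. -/
noncomputable def swapAtom (a b c : S.Atom) : S.Atom :=
  if c = a then b else if c = b then a else c

/-- The effect of a permutation on an atom:
`(a₁ b₁)⋯(aₙ bₙ)·c = (a₁ b₁)·((a₂ b₂)⋯(aₙ bₙ)·c)`. -/
noncomputable def Perm.app (π : Perm S) (c : S.Atom) : S.Atom :=
  π.foldr (fun p d => swapAtom p.1 p.2 d) c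

/-- Raw nominal terms: `t ::= f(t₁,…,tₙ) | a | a.t | π·X`. -/
inductive Term (S : Signature.{u}) : Type u
  | app (f : S.Fn) (ts : Fin (S.arity f) → Term S) : Term S
  | atom (a : S.Atom) : Term S
  | abs (a : S.Atom) (t : Term S) : Term S
  | susp (π : Perm S) (X : S.Var) : Term S

/-- `HasSort t τ`: the term `t` is well-sorted, of sort `τ`. -/
inductive HasSort : Term S → NSort S.ASort S.DSort → Prop
  | app (f : S.Fn) (ts : Fin (S.arity f) → Term S) (h : ∀ i, HasSort (ts i) (S.dom f i)) :
      HasSort (.app f ts) (.data (S.cod f))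
  | atom (a : S.Atom) : HasSort (.atom a) (.atom (S.atomSort a))
  | abs (a : S.Atom) (t : Term S) (τ : NSort S.ASort S.DSort) (h : HasSort t τ) :
      HasSort (.abs a t) (.abs (S.atomSort a) τ)
  | susp (π : Perm S) (X : S.Var) (h : π.WellSorted) : HasSort (.susp π X) (S.sortOfVar X)

/-- `Vars(t)`. -/
def Term.vars : Term S → Set S.Var
  | .app _ ts => ⋃ i, (ts i).vars
  | .atom _ => ∅
  | .abs _ t => t.vars
  | .susp _ X => {X}

/-- The effect `π·t` of a permutation on a term. -/
noncomputable def Term.perm (π : Perm S) : Term S → Term S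
  | .app f ts => .app f fun i => (ts i).perm π
  | .atom a => .atom (π.app a)
  | .abs a t => .abs (π.app a) (t.perm π)
  | .susp π' X => .susp (π ++ π') X

/-- Replaces every variable `X` by `m X`, possibly capturing atoms; the permutation of a
suspension is applied immediately. -/
noncomputable def Term.subst (m : S.Var → Term S) : Term S → Term S
  | .app f ts => .app f fun i => (ts i).subst m
  | .atom a => .atom a
  | .abs a t => .abs a (t.subst m)
  | .susp π X => (m X).perm π

theorem atomSort_app (π : Perm S) (hπ : π.WellSorted) (c : S.Atom) :
    S.atomSort (π.app c) = S.atomSort c := by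
  induction π with
  | nil => rfl
  | cons p π ih =>
    have h1 : S.atomSort p.1 = S.atomSort p.2 := hπ p (by simp)
    have h2 : S.atomSort (Perm.app π c) = S.atomSort c :=
      ih fun q hq => hπ q (List.mem_cons_of_mem _ hq)
    change S.atomSort (swapAtom p.1 p.2 (Perm.app π c)) = _
    unfold swapAtom
    split_ifs with h h'
    · rw [← h1, ← h, h2]
    · rw [h1, ← h', h2]
    · exact h2

theorem HasSort.perm {t : Term S} {τ : NSort S.ASort S.DSort} (ht : HasSort t τ)
    {π : Perm S} (hπ : π.WellSorted) : HasSort (t.perm π) τ := by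
  induction ht with
  | app f ts _ ih => exact .app f _ ih
  | atom a =>
    rw [← atomSort_app π hπ a]
    exact .atom _
  | abs a t τ _ ih =>
    rw [← atomSort_app π hπ a]
    exact .abs _ _ _ ih
  | susp π' X h =>
    refine .susp _ _ fun p hp => ?_
    rcases List.mem_append.1 hp with hp | hp
    · exact hπ p hp
    · exact h p hp

theorem HasSort.subst {t : Term S} {τ : NSort S.ASort S.DSort} (ht : HasSort t τ)
    {m : S.Var → Term S} (hm : ∀ X, HasSort (m X) (S.sortOfVar X)) : HasSort (t.subst m) τ := by
  induction ht with
  | app f ts _ ih => exact .app f _ ih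
  | atom a => exact .atom a
  | abs a t τ _ ih => exact .abs _ _ _ ih
  | susp π X h => exact (hm X).perm h

/-- A substitution `[X₁ ↦ t₁,…,Xₙ ↦ tₙ]`: a finite domain `{X₁,…,Xₙ}` (which may contain
variables mapped to themselves) and a sort-respecting map that is the identity off the domain. -/
structure Subst (S : Signature.{u}) where
  dom : Finset S.Var
  map : S.Var → Term S
  map_of_notMem : ∀ X, X ∉ dom → map X = .susp [] X
  hasSort : ∀ X, HasSort (map X) (S.sortOfVar X)

/-- The effect `σ(t)` of a substitution on a term. -/
noncomputable def Subst.apply (σ : Subst S) (t : Term S) : Term S := t.subst σ.map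

open Classical in
/-- `σ₁ ∘ σ₂ = [X ↦ σ₁(σ₂(X)) | X ∈ Dom(σ₁) ∪ Dom(σ₂)]`. -/
noncomputable def Subst.comp (σ₁ σ₂ : Subst S) : Subst S where
  dom := σ₁.dom ∪ σ₂.dom
  map X := σ₁.apply (σ₂.map X)
  map_of_notMem X hX := by
    rw [Finset.mem_union, not_or] at hX
    simp [Subst.apply, σ₂.map_of_notMem X hX.2, Term.subst, σ₁.map_of_notMem X hX.1, Term.perm]
  hasSort X := (σ₂.hasSort X).subst σ₁.hasSort

open Classical in
/-- `σ|_V = [X ↦ σ(X) | X ∈ V]`. -/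
noncomputable def Subst.restrict (σ : Subst S) (V : Finset S.Var) : Subst S where
  dom := V
  map X := if X ∈ V then σ.map X else .susp [] X
  map_of_notMem X hX := by simp [hX]
  hasSort X := by
    split_ifs
    · exact σ.hasSort X
    · exact .susp _ _ (by simp [Perm.WellSorted])

/-- A freshness environment: a list of constraints `a # X`. -/
abbrev FreshEnv (S : Signature.{u}) : Type u := List (S.Atom × S.Var)

/-- `∇ ⊢ a # t`. -/
inductive Fresh (E : FreshEnv S) (a : S.Atom) : Term S → Prop
  | atom (a' : S.Atom) (h : a ≠ a') : Fresh E a (.atom a')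
  | susp (π : Perm S) (X : S.Var) (h : (Perm.app π.reverse a, X) ∈ E) : Fresh E a (.susp π X)
  | app (f : S.Fn) (ts : Fin (S.arity f) → Term S) (h : ∀ i, Fresh E a (ts i)) :
      Fresh E a (.app f ts)
  | abs_same (t : Term S) : Fresh E a (.abs a t)
  | abs_diff (a' : S.Atom) (t : Term S) (hne : a ≠ a') (h : Fresh E a t) : Fresh E a (.abs a' t)

/-- `∇ ⊢ t ≈ u`. -/
inductive AlphaEq (E : FreshEnv S) : Term S → Term S → Prop
  | atom (a : S.Atom) : AlphaEq E (.atom a) (.atom a)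
  | susp (π π' : Perm S) (X : S.Var) (h : ∀ a, π.app a ≠ π'.app a → (a, X) ∈ E) :
      AlphaEq E (.susp π X) (.susp π' X)
  | app (f : S.Fn) (ts us : Fin (S.arity f) → Term S) (h : ∀ i, AlphaEq E (ts i) (us i)) :
      AlphaEq E (.app f ts) (.app f us)
  | abs_same (a : S.Atom) (t t' : Term S) (h : AlphaEq E t t') :
      AlphaEq E (.abs a t) (.abs a t')
  | abs_diff (a a' : S.Atom) (t t' : Term S) (hne : a ≠ a')
      (h : AlphaEq E t (t'.perm [(a, a')])) (hf : Fresh E a t') :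
      AlphaEq E (.abs a t) (.abs a' t')

/-- Equality equations `t ≈? u` and freshness equations `a #? t`. -/
inductive Equation (S : Signature.{u}) : Type u
  | eq (t u : Term S) : Equation S
  | fresh (a : S.Atom) (t : Term S) : Equation S

/-- The terms of an equation are well-sorted, and the two sides of an equality equation have
the same sort. -/
def Equation.WellSorted : Equation S → Prop
  | .eq t u => ∃ τ, HasSort t τ ∧ HasSort u τ
  | .fresh _ t => ∃ τ, HasSort t τ

/-- The variables of an equation. -/
def Equation.vars : Equation S → Set S.Var
  | .eq t u => t.vars ∪ u.vars
  | .fresh _ t => t.vars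

/-- A nominal unification problem: a finite set of well-sorted equations. -/
structure Problem (S : Signature.{u}) where
  eqs : Finset (Equation S)
  wellSorted : ∀ e ∈ eqs, e.WellSorted

/-- `Vars(P)`. -/
def Problem.vars (P : Problem S) : Set S.Var := {X | ∃ e ∈ P.eqs, X ∈ e.vars}

/-- A pair `⟨∇, σ⟩` of a freshness environment and a substitution. -/
structure Candidate (S : Signature.{u}) where
  env : FreshEnv S
  sub : Subst S

/-- The pair `⟨∇, σ⟩` satisfies an equation. -/
def Candidate.Satisfies (c : Candidate S) : Equation S → Prop
  | .eq t u => AlphaEq c.env (c.sub.apply t) (c.sub.apply u)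
  | .fresh a t => Fresh c.env a (c.sub.apply t)

/-- The solutions (unifiers) of `P`. -/
def Problem.unifiers (P : Problem S) : Set (Candidate S) :=
  {c | ∀ e ∈ P.eqs, c.Satisfies e}

/-- `∇₂ ⊢ σ(∇₁)`. -/
def EnvEntails (E₂ : FreshEnv S) (σ : Subst S) (E₁ : FreshEnv S) : Prop :=
  ∀ p ∈ E₁, Fresh E₂ p.1 (σ.map p.2)

open Classical in
/-- `∇ ⊢ σ₁ ≈ σ₂`. -/
def SubstEq (E : FreshEnv S) (σ₁ σ₂ : Subst S) : Prop :=
  ∀ X ∈ σ₁.dom ∪ σ₂.dom, AlphaEq E (σ₁.map X) (σ₂.map X)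

open Classical in
/-- `⟨∇₁, σ₁⟩` is more general than `⟨∇₂, σ₂⟩`: there is `σ'` with `∇₂ ⊢ σ'(∇₁)` and
`∇₂ ⊢ (σ' ∘ σ₁)|_{Dom(σ₁) ∪ Dom(σ₂)} ≈ σ₂`. -/
def Candidate.MoreGeneral (c₁ c₂ : Candidate S) : Prop :=
  ∃ σ' : Subst S, EnvEntails c₂.env σ' c₁.env ∧
    SubstEq c₂.env ((σ'.comp c₁.sub).restrict (c₁.sub.dom ∪ c₂.sub.dom)) c₂.sub

/-- `c` is a most general element of the class `U` of unifiers: every member of `U` that is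
more general than `c` is one that `c` is more general than. -/
def IsMostGeneral (U : Set (Candidate S)) (c : Candidate S) : Prop :=
  c ∈ U ∧ ∀ c' ∈ U, c'.MoreGeneral c → c.MoreGeneral c'

end Nominal

namespace Nominal

variable {S : Signature.{u}}

/-! ### Permutations -/

/-! A solvable problem has a principal unifier `⟨∇₀, σ₀⟩`: every unifier `⟨∇, σ⟩` satisfies `∇ ⊢
σ(∇₀)` and `∇ ⊢ σ(σ₀(X)) ≈ σ(X)` for all `X`, so that `σ` itself is the mediating substitution
(`Problem.exists_isPrincipal`). "More general" sees only the variables in the two domains, so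
comparisons cannot simply be chained. Instead `σ₀` is given a domain `V` that contains both domains
in play and loses no variable of `P` that `σ₀` moves. The result is still a unifier, and it is more
general than `⟨∇₁, σ₁⟩`. Maximality returns some `σ` with `σ(σ₁(X)) ≈ σ₀(X)` on `V`, whence
`σ₂(σ(σ₁(X))) ≈ σ₂(σ₀(X)) ≈ σ₂(X)`: `σ₂ ∘ σ` shows that the first unifier is more general than the
second (`IsMostGeneral.moreGeneral`).

Principal unifiers come from the unification algorithm, as an induction on the total size of the
equality equations instantiated by one fixed solution. This solution rules out clashes and
occurs-check failures, and survives every step up to `≈`, which preserves size.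

That `≈` is an equivalence stable under permutation and substitution is proved through `Matches`,
which reads terms as de Bruijn terms and so needs no renaming at binders. -/

theorem Perm.app_append (π π' : Perm S) (a : S.Atom) :
    Perm.app (π ++ π') a = π.app (π'.app a) := by
  simp [Perm.app, List.foldr_append]

theorem swapAtom_swapAtom (a b c : S.Atom) : swapAtom a b (swapAtom a b c) = c := by
  unfold swapAtom
  by_cases h : c = a <;> by_cases h' : c = b <;> by_cases h'' : b = a <;> simp_all

theorem Perm.app_cons (p : S.Atom × S.Atom) (π : Perm S) (a : S.Atom) :
    Perm.app (p :: π) a = swapAtom p.1 p.2 (π.app a) := rfl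

theorem Perm.app_reverse_app (π : Perm S) (a : S.Atom) : Perm.app π.reverse (π.app a) = a := by
  induction π with
  | nil => rfl
  | cons p π ih =>
    rw [List.reverse_cons, Perm.app_append, Perm.app_cons]
    change Perm.app π.reverse (swapAtom p.1 p.2 (swapAtom p.1 p.2 (Perm.app π a))) = a
    rw [swapAtom_swapAtom, ih]

theorem Perm.app_app_reverse (π : Perm S) (a : S.Atom) : π.app (Perm.app π.reverse a) = a := by
  simpa using Perm.app_reverse_app (S := S) π.reverse a

theorem Perm.app_injective (π : Perm S) : Function.Injective π.app :=
  Function.LeftInverse.injective (Perm.app_reverse_app π)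

theorem Perm.WellSorted.reverse {π : Perm S} (h : π.WellSorted) :
    Perm.WellSorted (S := S) π.reverse := fun p hp => h p (List.mem_reverse.1 hp)

theorem Perm.exists_support (π : Perm S) : ∃ l : List S.Atom, ∀ a ∉ l, π.app a = a := by
  induction π with
  | nil => exact ⟨[], fun a _ => rfl⟩
  | cons p π ih =>
    obtain ⟨l, hl⟩ := ih
    refine ⟨p.1 :: p.2 :: l, fun a ha => ?_⟩
    simp only [List.mem_cons, not_or] at ha
    rw [Perm.app_cons, hl a ha.2.2, swapAtom, if_neg ha.1, if_neg ha.2.1]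

open Classical in
-- Disagreement happens only inside the finite supports. This lets an equation between two
-- suspensions of one variable be traded for finitely many freshness equations.
theorem Perm.exists_disagreement (π π' : Perm S) :
    ∃ l : List S.Atom, ∀ a, a ∈ l ↔ π.app a ≠ π'.app a := by
  obtain ⟨l, hl⟩ := π.exists_support
  obtain ⟨l', hl'⟩ := π'.exists_support
  refine ⟨(l ++ l').filter fun a => π.app a ≠ π'.app a, fun a => ?_⟩
  simp only [List.mem_filter, List.mem_append, decide_eq_true_eq, and_iff_right_iff_imp]
  intro h
  by_contra hn
  rw [not_or] at hn
  exact h (by rw [hl a hn.1, hl' a hn.2])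

/-! ### Terms and substitutions -/

theorem Term.perm_nil (t : Term S) : t.perm [] = t := by
  induction t with
  | app f ts ih => simp [Term.perm, ih]
  | atom a => rfl
  | abs a t ih => simp [Term.perm, ih]; rfl
  | susp π X => rfl

theorem Term.perm_perm (π π' : Perm S) (t : Term S) :
    (t.perm π').perm π = t.perm (π ++ π') := by
  induction t with
  | app f ts ih => simp [Term.perm, ih]
  | atom a => simp [Term.perm, Perm.app_append]
  | abs a t ih => simp [Term.perm, ih, Perm.app_append]
  | susp π'' X => simp [Term.perm, List.append_assoc]

theorem Term.subst_perm (m : S.Var → Term S) (π : Perm S) (t : Term S) :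
    (t.perm π).subst m = (t.subst m).perm π := by
  induction t with
  | app f ts ih => simp [Term.perm, Term.subst, ih]
  | atom a => rfl
  | abs a t ih => simp [Term.perm, Term.subst, ih]
  | susp π'' X => simp [Term.perm, Term.subst, Term.perm_perm]

theorem Term.subst_subst (m m' : S.Var → Term S) (t : Term S) :
    (t.subst m').subst m = t.subst fun X => (m' X).subst m := by
  induction t with
  | app f ts ih => simp [Term.subst, ih]
  | atom a => rfl
  | abs a t ih => simp [Term.subst, ih]
  | susp π X => simp [Term.subst, Term.subst_perm]

theorem Term.subst_congr {m m' : S.Var → Term S} {t : Term S}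
    (h : ∀ X ∈ t.vars, m X = m' X) : t.subst m = t.subst m' := by
  induction t with
  | app f ts ih =>
    simp only [Term.subst]
    congr 1
    funext i
    exact ih i fun X hX => h X (Set.mem_iUnion.2 ⟨i, hX⟩)
  | atom a => rfl
  | abs a t ih => simp only [Term.subst]; rw [ih h]
  | susp π X => simp only [Term.subst]; rw [h X rfl]

theorem Term.subst_id (t : Term S) : t.subst (fun X => .susp [] X) = t := by
  induction t with
  | app f ts ih => simp [Term.subst, ih]
  | atom a => rfl
  | abs a t ih => simp [Term.subst, ih]
  | susp π X => simp [Term.subst, Term.perm]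

theorem Subst.comp_apply (σ τ : Subst S) (t : Term S) :
    (σ.comp τ).apply t = σ.apply (τ.apply t) :=
  (Term.subst_subst σ.map τ.map t).symm

/-! ### Sizes -/

/-- The number of nodes of a term. -/
def Term.size : Term S → ℕ
  | .app _ ts => 1 + ∑ i, (ts i).size
  | .atom _ => 1
  | .abs _ t => 1 + t.size
  | .susp _ _ => 1

theorem Term.size_pos (t : Term S) : 0 < t.size := by
  cases t <;> simp [Term.size]

theorem Term.size_perm (π : Perm S) (t : Term S) : (t.perm π).size = t.size := by
  induction t with
  | app f ts ih => simp [Term.perm, Term.size, ih]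
  | atom a => rfl
  | abs a t ih => simp [Term.perm, Term.size, ih]
  | susp π X => rfl

theorem AlphaEq.size_eq {E : FreshEnv S} {t u : Term S} (h : AlphaEq E t u) :
    t.size = u.size := by
  induction h with
  | atom a => rfl
  | susp => rfl
  | app f ts us h ih => simp [Term.size, ih]
  | abs_same a t t' h ih => simp [Term.size, ih]
  | abs_diff a a' t t' hne h hf ih => simp [Term.size, ih, Term.size_perm]

theorem Term.size_le_size_subst (m : S.Var → Term S) {X : S.Var} {t : Term S}
    (h : X ∈ t.vars) : (m X).size ≤ (t.subst m).size := by
  induction t with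
  | app f ts ih =>
    obtain ⟨i, hi⟩ := Set.mem_iUnion.1 h
    have h1 := Finset.single_le_sum (f := fun i => ((ts i).subst m).size)
      (fun _ _ => Nat.zero_le _) (Finset.mem_univ i)
    have h2 := ih i hi
    simp only [Term.subst, Term.size]
    omega
  | atom a => exact absurd h (Set.notMem_empty X)
  | abs a t ih =>
    have := ih h
    simp only [Term.subst, Term.size]
    omega
  | susp π Y =>
    rw [show X = Y from h, Term.subst, Term.size_perm]

/-- The occurs check: since `≈` preserves size, `π·X` and `t` then have no common instance. -/
theorem Term.size_lt_size_subst (m : S.Var → Term S) {X : S.Var} {t : Term S}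
    (h : X ∈ t.vars) (ht : ∀ π, t ≠ .susp π X) : (m X).size < (t.subst m).size := by
  cases t with
  | app f ts =>
    obtain ⟨i, hi⟩ := Set.mem_iUnion.1 h
    have h1 := Finset.single_le_sum (f := fun i => ((ts i).subst m).size)
      (fun _ _ => Nat.zero_le _) (Finset.mem_univ i)
    have h2 := Term.size_le_size_subst m hi
    simp only [Term.subst, Term.size]
    omega
  | atom a => exact absurd h (Set.notMem_empty X)
  | abs a t =>
    have := Term.size_le_size_subst (t := t) m h
    simp only [Term.subst, Term.size]
    omega
  | susp π Y => exact absurd (by rw [show X = Y from h]) (ht π)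

/-! ### Freshness -/

theorem Fresh.perm {E : FreshEnv S} {a : S.Atom} {t : Term S} (h : Fresh E a t) (π : Perm S) :
    Fresh E (π.app a) (t.perm π) := by
  induction h with
  | atom a' h => exact .atom _ (π.app_injective.ne h)
  | susp π' X h =>
    refine .susp _ _ ?_
    rwa [List.reverse_append, Perm.app_append, Perm.app_reverse_app]
  | app f ts h ih => exact .app _ _ ih
  | abs_same t => exact .abs_same _
  | abs_diff a' t hne h ih => exact .abs_diff _ _ (π.app_injective.ne hne) ih

theorem Fresh.subst {E E' : FreshEnv S} {σ : Subst S} (hσ : EnvEntails E' σ E) {a : S.Atom}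
    {t : Term S} (h : Fresh E a t) : Fresh E' a (σ.apply t) := by
  induction h with
  | atom a' h => exact .atom _ h
  | susp π X h =>
    have h' := (hσ _ h).perm π
    rwa [Perm.app_app_reverse] at h'
  | app f ts h ih => exact .app _ _ ih
  | abs_same t => exact .abs_same _
  | abs_diff a' t hne h ih => exact .abs_diff _ _ hne ih

theorem fresh_susp_nil {E : FreshEnv S} {a : S.Atom} {X : S.Var} (h : (a, X) ∈ E) :
    Fresh E a (.susp [] X) := .susp _ _ h

theorem fresh_atom_iff {E : FreshEnv S} {a b : S.Atom} : Fresh E a (.atom b) ↔ a ≠ b :=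
  ⟨fun h => by cases h; assumption, .atom _⟩

theorem fresh_susp_iff {E : FreshEnv S} {a : S.Atom} {π : Perm S} {X : S.Var} :
    Fresh E a (.susp π X) ↔ (Perm.app π.reverse a, X) ∈ E :=
  ⟨fun h => by cases h; assumption, .susp _ _⟩

theorem fresh_app_iff {E : FreshEnv S} {a : S.Atom} {f : S.Fn} {ts : Fin (S.arity f) → Term S} :
    Fresh E a (.app f ts) ↔ ∀ i, Fresh E a (ts i) :=
  ⟨fun h => by cases h; assumption, .app _ _⟩

theorem fresh_abs_iff {E : FreshEnv S} {a b : S.Atom} {t : Term S} :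
    Fresh E a (.abs b t) ↔ a = b ∨ Fresh E a t := by
  constructor
  · intro h
    cases h with
    | abs_same => exact .inl rfl
    | abs_diff _ _ _ h => exact .inr h
  · intro h
    by_cases hab : a = b
    · subst hab; exact .abs_same _
    · exact .abs_diff _ _ hab (h.resolve_left hab)

/-! ### α-equivalence relative to valuations of the atoms -/

/-- A valuation of atoms by de Bruijn indices or free atoms. -/
abbrev Valuation (S : Signature.{u}) : Type u := S.Atom → ℕ ⊕ S.Atom

/-- The renumbering of values when a binder is crossed. -/
def shift : ℕ ⊕ S.Atom → ℕ ⊕ S.Atom := Sum.map Nat.succ id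

theorem shift_injective : Function.Injective (shift (S := S)) :=
  Sum.map_injective.2 ⟨Nat.succ_injective, Function.injective_id⟩

theorem shift_ne_zero (v : ℕ ⊕ S.Atom) : shift v ≠ .inl 0 := by
  cases v <;> simp [shift]

open Classical in
/-- The valuation below a binder of `a`. -/
noncomputable def Valuation.bind (ρ : Valuation S) (a : S.Atom) : Valuation S := fun b =>
  if b = a then .inl 0 else shift (ρ b)

theorem Valuation.bind_self (ρ : Valuation S) (a : S.Atom) : ρ.bind a a = .inl 0 := if_pos rfl

theorem Valuation.bind_of_ne (ρ : Valuation S) {a b : S.Atom} (h : b ≠ a) :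
    ρ.bind a b = shift (ρ b) := if_neg h

theorem Valuation.bind_injective {ρ : Valuation S} (hρ : Function.Injective ρ) (a : S.Atom) :
    Function.Injective (ρ.bind a) := by
  intro b c h
  by_cases hb : b = a <;> by_cases hc : c = a
  · rw [hb, hc]
  · rw [hb, ρ.bind_self, ρ.bind_of_ne hc] at h
    exact absurd h.symm (shift_ne_zero _)
  · rw [hc, ρ.bind_self, ρ.bind_of_ne hb] at h
    exact absurd h (shift_ne_zero _)
  · rw [ρ.bind_of_ne hb, ρ.bind_of_ne hc] at h
    exact hρ (shift_injective h)

theorem Valuation.bind_comp_perm (ρ : Valuation S) (π : Perm S) (a : S.Atom) :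
    ρ.bind (π.app a) ∘ π.app = Valuation.bind (ρ ∘ π.app) a := by
  funext b
  by_cases h : b = a
  · simp [h, Valuation.bind_self]
  · rw [Function.comp_apply, bind_of_ne _ (π.app_injective.ne h), bind_of_ne _ h]
    rfl

/-- `Matches E ρ t ρ' u`: the terms `t` and `u` have α-equivalent interpretations when their free
atoms are interpreted by `ρ` and `ρ'`, respectively. -/
inductive Matches (E : FreshEnv S) : Valuation S → Term S → Valuation S → Term S → Prop
  | atom (ρ ρ' : Valuation S) (a b : S.Atom) (h : ρ a = ρ' b) :
      Matches E ρ (.atom a) ρ' (.atom b)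
  | susp (ρ ρ' : Valuation S) (π π' : Perm S) (X : S.Var)
      (h : ∀ a, ρ (π.app a) ≠ ρ' (π'.app a) → (a, X) ∈ E) :
      Matches E ρ (.susp π X) ρ' (.susp π' X)
  | app (ρ ρ' : Valuation S) (f : S.Fn) (ts us : Fin (S.arity f) → Term S)
      (h : ∀ i, Matches E ρ (ts i) ρ' (us i)) : Matches E ρ (.app f ts) ρ' (.app f us)
  | abs (ρ ρ' : Valuation S) (a b : S.Atom) (t u : Term S)
      (h : Matches E (ρ.bind a) t (ρ'.bind b) u) : Matches E ρ (.abs a t) ρ' (.abs b u)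

namespace Matches

variable {E : FreshEnv S} {ρ ρ' ρ'' : Valuation S} {t u v : Term S}

theorem symm (h : Matches E ρ t ρ' u) : Matches E ρ' u ρ t := by
  induction h with
  | atom ρ ρ' a b h => exact .atom _ _ _ _ h.symm
  | susp ρ ρ' π π' X h => exact .susp _ _ _ _ _ fun a ha => h a ha.symm
  | app ρ ρ' f ts us h ih => exact .app _ _ _ _ _ ih
  | abs ρ ρ' a b t u h ih => exact .abs _ _ _ _ _ _ ih

/-- Each side carries its own valuation, so the induction is structural. At a suspension, values
that differ between the outer readings differ from the middle one on at least one side. -/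
theorem trans (h : Matches E ρ t ρ' u) (h' : Matches E ρ' u ρ'' v) : Matches E ρ t ρ'' v := by
  induction h generalizing ρ'' v with
  | atom ρ ρ' a b h =>
    cases h' with
    | atom _ _ _ c h' => exact .atom _ _ _ _ (h.trans h')
  | susp ρ ρ' π π' X h =>
    cases h' with
    | susp _ _ _ π'' _ h' =>
      refine .susp _ _ _ _ _ fun a ha => ?_
      by_cases hc : ρ (π.app a) = ρ' (π'.app a)
      · exact h' a (hc ▸ ha)
      · exact h a hc
  | app ρ ρ' f ts us h ih =>
    cases h' with
    | app _ _ _ _ vs h' => exact .app _ _ _ _ _ fun i => ih i (h' i)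
  | abs ρ ρ' a b t u h ih =>
    cases h' with
    | abs _ _ _ c _ v h' => exact .abs _ _ _ _ _ _ (ih h')

/-- Two readings of one term agree exactly when the valuations differ only at atoms fresh for it;
below a binder of `b` they always agree at `b`. -/
theorem self_iff : Matches E ρ t ρ' t ↔ ∀ a, ρ a ≠ ρ' a → Fresh E a t := by
  induction t generalizing ρ ρ' with
  | app f ts ih =>
    simp only [fresh_app_iff]
    constructor
    · intro h a ha i
      cases h with
      | app _ _ _ _ _ h => exact (ih i).1 (h i) a ha
    · exact fun h => .app _ _ _ _ _ fun i => (ih i).2 fun a ha => h a ha i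
  | atom b =>
    simp only [fresh_atom_iff]
    constructor
    · rintro h a ha rfl
      cases h with
      | atom _ _ _ _ h => exact ha h
    · exact fun h => .atom _ _ _ _ (by by_contra hb; exact h b hb rfl)
  | abs b t ih =>
    simp only [fresh_abs_iff]
    constructor
    · intro h a ha
      cases h with
      | abs _ _ _ _ _ _ h =>
        by_cases hab : a = b
        · exact .inl hab
        · refine .inr (ih.1 h a ?_)
          rw [Valuation.bind_of_ne _ hab, Valuation.bind_of_ne _ hab]
          exact shift_injective.ne ha
    · refine fun h => .abs _ _ _ _ _ _ (ih.2 fun a ha => ?_)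
      by_cases hab : a = b
      · rw [hab, Valuation.bind_self, Valuation.bind_self] at ha
        exact absurd rfl ha
      · rw [Valuation.bind_of_ne _ hab, Valuation.bind_of_ne _ hab] at ha
        exact (h a fun he => ha (by rw [he])).resolve_left hab
  | susp π X =>
    simp only [fresh_susp_iff]
    constructor
    · intro h a ha
      cases h with
      | susp _ _ _ _ _ h =>
        refine h _ ?_
        rwa [Perm.app_app_reverse]
    · refine fun h => .susp _ _ _ _ _ fun a ha => ?_
      have := h _ ha
      rwa [Perm.app_reverse_app] at this

theorem refl (ρ : Valuation S) (t : Term S) : Matches E ρ t ρ t :=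
  self_iff.2 fun _ h => absurd rfl h

theorem perm_self (ρ : Valuation S) (π : Perm S) (t : Term S) :
    Matches E ρ (t.perm π) (ρ ∘ π.app) t := by
  induction t generalizing ρ with
  | app f ts ih => exact .app _ _ _ _ _ fun i => ih i ρ
  | atom a => exact .atom _ _ _ _ rfl
  | abs a t ih =>
    refine .abs _ _ _ _ _ _ ?_
    rw [← Valuation.bind_comp_perm]
    exact ih _
  | susp π' X =>
    refine .susp _ _ _ _ _ fun a ha => absurd ?_ ha
    rw [Perm.app_append]
    rfl

/-- Freshness is a property of values rather than names. The value `w` varies in the induction: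
below a binder it becomes `shift w`, which the bound atom, of value `0`, never takes. -/
theorem fresh (h : Matches E ρ t ρ' u) {w : ℕ ⊕ S.Atom}
    (ht : ∀ a, ρ a = w → Fresh E a t) : ∀ a, ρ' a = w → Fresh E a u := by
  induction h generalizing w with
  | atom ρ ρ' b c h =>
    rintro a ha
    refine fresh_atom_iff.2 ?_
    rintro rfl
    exact fresh_atom_iff.1 (ht b (h.trans ha)) rfl
  | susp ρ ρ' π π' X h =>
    intro a ha
    refine fresh_susp_iff.2 ?_
    by_cases hc : ρ (π.app (Perm.app π'.reverse a)) = ρ' (π'.app (Perm.app π'.reverse a))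
    · have := ht _ (hc.trans ((congrArg ρ' (Perm.app_app_reverse _ _)).trans ha))
      rw [fresh_susp_iff, Perm.app_reverse_app] at this
      exact this
    · exact h _ hc
  | app ρ ρ' f ts us h ih =>
    exact fun a ha => fresh_app_iff.2 fun i => ih i (fun b hb => fresh_app_iff.1 (ht b hb) i) a ha
  | abs ρ ρ' b c t u h ih =>
    intro a ha
    rw [fresh_abs_iff]
    by_cases hac : a = c
    · exact .inl hac
    · refine .inr (ih (w := shift w) (fun d hd => ?_) a ?_)
      · by_cases hdb : d = b
        · rw [hdb, Valuation.bind_self] at hd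
          exact absurd hd.symm (shift_ne_zero _)
        · rw [Valuation.bind_of_ne _ hdb] at hd
          exact (fresh_abs_iff.1 (ht d (shift_injective hd))).resolve_left hdb
      · rw [Valuation.bind_of_ne _ hac, ha]

theorem perm_iff {π π' : Perm S} :
    Matches E ρ (t.perm π) ρ' (u.perm π') ↔ Matches E (ρ ∘ π.app) t (ρ' ∘ π'.app) u :=
  ⟨fun h => (perm_self ρ π t).symm.trans (h.trans (perm_self ρ' π' u)),
    fun h => (perm_self ρ π t).trans (h.trans (perm_self ρ' π' u).symm)⟩

theorem subst {E' : FreshEnv S} {σ : Subst S} (hσ : EnvEntails E' σ E)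
    (h : Matches E ρ t ρ' u) : Matches E' ρ (σ.apply t) ρ' (σ.apply u) := by
  induction h with
  | atom ρ ρ' a b h => exact .atom _ _ _ _ h
  | susp ρ ρ' π π' X h => exact perm_iff.2 (self_iff.2 fun a ha => hσ _ (h a ha))
  | app ρ ρ' f ts us h ih => exact .app _ _ _ _ _ ih
  | abs ρ ρ' a b t u h ih => exact .abs _ _ _ _ _ _ ih

/-- The two valuations can differ only at `a`, which is fresh for `t`. This is what connects the
swapping in the rule `abs_diff` with the binders of `Matches`. -/
theorem bind_swap {a b : S.Atom} (ρ : Valuation S) (hf : Fresh E a t) :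
    Matches E (ρ.bind a ∘ Perm.app [(a, b)]) t (ρ.bind b) t := by
  refine self_iff.2 fun c hc => ?_
  by_cases hca : c = a
  · rwa [hca]
  · refine absurd ?_ hc
    change ρ.bind a (swapAtom a b c) = ρ.bind b c
    unfold swapAtom
    by_cases hcb : c = b
    · rw [if_neg hca, if_pos hcb, hcb, Valuation.bind_self, Valuation.bind_self]
    · rw [if_neg hca, if_neg hcb, Valuation.bind_of_ne _ hca, Valuation.bind_of_ne _ hcb]

/-- Injectivity turns equal values back into equal atoms, and it is inherited by `bind`. After the
swapping is put back on the right, both sides again share one valuation. -/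
theorem alphaEq (h : Matches E ρ t ρ u) (hρ : Function.Injective ρ) : AlphaEq E t u := by
  induction t generalizing ρ u with
  | app f ts ih =>
    cases h with
    | app _ _ _ _ us h => exact .app _ _ _ fun i => ih i (h i) hρ
  | atom a =>
    cases h with
    | atom _ _ _ b h => rw [hρ h]; exact .atom _
  | susp π X =>
    cases h with
    | susp _ _ _ π' _ h => exact .susp _ _ _ fun a ha => h a (hρ.ne ha)
  | abs a t ih =>
    cases h with
    | abs _ _ _ b _ u h =>
      by_cases hab : a = b
      · subst hab
        exact .abs_same _ _ _ (ih h (Valuation.bind_injective hρ a))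
      -- Under `ρ.bind a` no atom has the value `shift (ρ a)`, so freshness on the side of `t` is
      -- vacuous; under `ρ.bind b` the atom `a` has this value.
      · have hf : Fresh E a u := by
          refine h.fresh (w := shift (ρ a)) (fun c hc => ?_) a (Valuation.bind_of_ne _ hab)
          by_cases hca : c = a
          · rw [hca, Valuation.bind_self] at hc
            exact absurd hc.symm (shift_ne_zero _)
          · rw [Valuation.bind_of_ne _ hca] at hc
            exact absurd (hρ (shift_injective hc)) hca
        refine .abs_diff _ _ _ _ hab (ih ?_ (Valuation.bind_injective hρ a)) hf
        exact h.trans ((bind_swap ρ hf).symm.trans (perm_self _ _ _).symm)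

end Matches

theorem AlphaEq.matches {E : FreshEnv S} {t u : Term S} (h : AlphaEq E t u) (ρ : Valuation S) :
    Matches E ρ t ρ u := by
  induction h generalizing ρ with
  | atom a => exact .refl _ _
  | susp π π' X h => exact .susp _ _ _ _ _ fun a ha => h a fun he => ha (by rw [he])
  | app f ts us h ih => exact .app _ _ _ _ _ fun i => ih i ρ
  | abs_same a t t' h ih => exact .abs _ _ _ _ _ _ (ih _)
  | abs_diff a a' t t' hne h hf ih =>
    exact .abs _ _ _ _ _ _
      ((ih _).trans ((Matches.perm_self _ _ _).trans (Matches.bind_swap ρ hf)))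

theorem alphaEq_iff_matches {E : FreshEnv S} {t u : Term S} :
    AlphaEq E t u ↔ Matches E Sum.inr t Sum.inr u :=
  ⟨fun h => h.matches _, fun h => h.alphaEq Sum.inr_injective⟩

/-! ### Properties of α-equivalence -/

section AlphaEq

variable {E E' : FreshEnv S} {t u v : Term S}

theorem AlphaEq.refl (t : Term S) : AlphaEq E t t :=
  alphaEq_iff_matches.2 (.refl _ _)

theorem AlphaEq.symm (h : AlphaEq E t u) : AlphaEq E u t :=
  alphaEq_iff_matches.2 (alphaEq_iff_matches.1 h).symm

theorem AlphaEq.trans (h : AlphaEq E t u) (h' : AlphaEq E u v) : AlphaEq E t v :=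
  alphaEq_iff_matches.2 ((alphaEq_iff_matches.1 h).trans (alphaEq_iff_matches.1 h'))

theorem AlphaEq.perm (h : AlphaEq E t u) (π : Perm S) : AlphaEq E (t.perm π) (u.perm π) :=
  alphaEq_iff_matches.2 (Matches.perm_iff.2 (h.matches _))

theorem AlphaEq.subst {σ : Subst S} (hσ : EnvEntails E' σ E) (h : AlphaEq E t u) :
    AlphaEq E' (σ.apply t) (σ.apply u) :=
  alphaEq_iff_matches.2 ((alphaEq_iff_matches.1 h).subst hσ)

theorem alphaEq_perm_perm_iff {π π' : Perm S} :
    AlphaEq E (t.perm π) (t.perm π') ↔ ∀ a, π.app a ≠ π'.app a → Fresh E a t := by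
  rw [alphaEq_iff_matches, Matches.perm_iff, Matches.self_iff]
  simp

theorem AlphaEq.fresh (h : AlphaEq E t u) {a : S.Atom} (ht : Fresh E a t) : Fresh E a u :=
  (alphaEq_iff_matches.1 h).fresh (w := .inr a) (fun _ hb => Sum.inr_injective hb ▸ ht) a rfl

theorem alphaEq_perm_reverse (π : Perm S) (t : Term S) :
    AlphaEq E ((t.perm π).perm π.reverse) t := by
  have h : AlphaEq E (t.perm (π.reverse ++ π : Perm S)) (t.perm []) :=
    alphaEq_perm_perm_iff.2 fun a ha => absurd (by
      rw [Perm.app_append, Perm.app_reverse_app]; rfl) ha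
  rwa [← Term.perm_perm, Term.perm_nil] at h

theorem alphaEq_reverse_perm (π : Perm S) (t : Term S) :
    AlphaEq E ((t.perm π.reverse).perm π) t := by
  simpa using alphaEq_perm_reverse (E := E) (S := S) π.reverse t

theorem alphaEq_subst_of_forall {m m' : S.Var → Term S} (h : ∀ X, AlphaEq E (m X) (m' X))
    (t : Term S) : AlphaEq E (t.subst m) (t.subst m') := by
  induction t with
  | app f ts ih => exact .app _ _ _ ih
  | atom a => exact .atom _
  | abs a t ih => exact .abs_same _ _ _ ih
  | susp π X => exact (h X).perm π

theorem alphaEq_app_iff {f : S.Fn} {ts us : Fin (S.arity f) → Term S} :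
    AlphaEq E (.app f ts) (.app f us) ↔ ∀ i, AlphaEq E (ts i) (us i) :=
  ⟨fun h => by cases h; assumption, .app _ _ _⟩

theorem alphaEq_abs_same_iff {a : S.Atom} :
    AlphaEq E (.abs a t) (.abs a u) ↔ AlphaEq E t u := by
  refine ⟨fun h => ?_, .abs_same _ _ _⟩
  cases h with
  | abs_same _ _ _ h => exact h
  | abs_diff _ _ _ _ hne => exact absurd rfl hne

theorem alphaEq_abs_diff_iff {a b : S.Atom} (hab : a ≠ b) :
    AlphaEq E (.abs a t) (.abs b u) ↔ AlphaEq E t (u.perm [(a, b)]) ∧ Fresh E a u := by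
  refine ⟨fun h => ?_, fun h => .abs_diff _ _ _ _ hab h.1 h.2⟩
  cases h with
  | abs_same => exact absurd rfl hab
  | abs_diff _ _ _ _ _ h hf => exact ⟨h, hf⟩

end AlphaEq

/-! ### Principal solutions -/

/-- The solutions of a list of equality equations and a list of freshness equations. -/
def solutions (L : List (Term S × Term S)) (F : List (S.Atom × Term S)) : Set (Candidate S) :=
  {c | (∀ p ∈ L, AlphaEq c.env (c.sub.apply p.1) (c.sub.apply p.2)) ∧
    ∀ q ∈ F, Fresh c.env q.1 (c.sub.apply q.2)}

/-- A member of a class of candidates of which every other member is an instance, without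
restriction to the domains of the substitutions. -/
def IsPrincipal (U : Set (Candidate S)) (c₀ : Candidate S) : Prop :=
  c₀ ∈ U ∧ ∀ c ∈ U, EnvEntails c.env c.sub c₀.env ∧
    ∀ X, AlphaEq c.env (c.sub.apply (c₀.sub.map X)) (c.sub.map X)

/-- The identity substitution, with empty domain. -/
noncomputable def Subst.id : Subst S where
  dom := ∅
  map X := .susp [] X
  map_of_notMem _ _ := rfl
  hasSort X := .susp _ _ (by simp [Perm.WellSorted])

open Classical in
/-- The substitution `[X ↦ t]`. -/
noncomputable def Subst.single (X : S.Var) (t : Term S) (ht : HasSort t (S.sortOfVar X)) :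
    Subst S where
  dom := {X}
  map Y := if Y = X then t else .susp [] Y
  map_of_notMem Y hY := if_neg (by simpa using hY)
  hasSort Y := by
    split_ifs with h
    · rwa [h]
    · exact .susp _ _ (by simp [Perm.WellSorted])

/-- Freshness decomposes into constraints on variables, the same for all candidates. Solvability
excludes the one contradictory leaf, `a # a`. -/
theorem exists_env_of_fresh (a : S.Atom) (t : Term S)
    (h : ∃ c : Candidate S, Fresh c.env a (c.sub.apply t)) :
    ∃ E₀ : FreshEnv S, ∀ c : Candidate S,
      EnvEntails c.env c.sub E₀ ↔ Fresh c.env a (c.sub.apply t) := by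
  induction t with
  | app f ts ih =>
    obtain ⟨c, hc⟩ := h
    have hc' := fresh_app_iff.1 hc
    choose E₀ hE₀ using fun i => ih i ⟨c, hc' i⟩
    refine ⟨(List.ofFn E₀).flatten, fun c => ?_⟩
    rw [show c.sub.apply (.app f ts) = .app f fun i => c.sub.apply (ts i) from rfl, fresh_app_iff]
    simp only [← hE₀, EnvEntails, List.mem_flatten, List.mem_ofFn]
    constructor
    · exact fun h i p hp => h p ⟨_, ⟨i, rfl⟩, hp⟩
    · rintro h p ⟨_, ⟨i, rfl⟩, hp⟩
      exact h i p hp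
  | atom b =>
    obtain ⟨c, hc⟩ := h
    have hab := fresh_atom_iff.1 hc
    exact ⟨[], fun c => ⟨fun _ => .atom _ hab, fun _ p hp => absurd hp (by simp)⟩⟩
  | abs b t ih =>
    by_cases hab : a = b
    · subst hab
      exact ⟨[], fun c => ⟨fun _ => .abs_same _, fun _ p hp => absurd hp (by simp)⟩⟩
    · obtain ⟨c, hc⟩ := h
      obtain ⟨E₀, hE₀⟩ := ih ⟨c, (fresh_abs_iff.1 hc).resolve_left hab⟩
      refine ⟨E₀, fun c => (hE₀ c).trans ?_⟩
      exact ⟨fun h => .abs_diff _ _ hab h, fun h => (fresh_abs_iff.1 h).resolve_left hab⟩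
  | susp π X =>
    refine ⟨[(Perm.app π.reverse a, X)], fun c => ?_⟩
    simp only [EnvEntails, List.mem_singleton, forall_eq]
    constructor
    · intro h
      have := h.perm π
      rwa [Perm.app_app_reverse] at this
    · intro h
      exact (alphaEq_perm_reverse π _).fresh (Fresh.perm h π.reverse)

theorem exists_env_of_fresh_list (F : List (S.Atom × Term S))
    (h : (solutions [] F).Nonempty) :
    ∃ E₀ : FreshEnv S, ∀ c : Candidate S,
      EnvEntails c.env c.sub E₀ ↔ ∀ q ∈ F, Fresh c.env q.1 (c.sub.apply q.2) := by
  obtain ⟨c, -, hc⟩ := h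
  induction F with
  | nil => exact ⟨[], fun c => by simp [EnvEntails]⟩
  | cons q F ih =>
    obtain ⟨E₁, h₁⟩ := exists_env_of_fresh q.1 q.2 ⟨c, hc q (by simp)⟩
    obtain ⟨E₂, h₂⟩ := ih fun q' hq' => hc q' (List.mem_cons_of_mem _ hq')
    refine ⟨E₁ ++ E₂, fun c => ?_⟩
    rw [List.forall_mem_cons, ← h₁, ← h₂]
    exact List.forall_mem_append

theorem exists_isPrincipal_nil (F : List (S.Atom × Term S)) (h : (solutions [] F).Nonempty) :
    ∃ c₀, IsPrincipal (solutions [] F) c₀ := by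
  obtain ⟨E₀, hE₀⟩ := exists_env_of_fresh_list F h
  refine ⟨⟨E₀, Subst.id⟩, ⟨by simp, (hE₀ ⟨E₀, Subst.id⟩).1 fun p hp => fresh_susp_nil hp⟩,
    fun c hc => ⟨(hE₀ c).2 hc.2, fun X => ?_⟩⟩
  change AlphaEq c.env ((c.sub.map X).perm []) (c.sub.map X)
  rw [Term.perm_nil]
  exact .refl _

/-- Here `τ` is `[X ↦ π⁻¹·t]`. A principal solution `σ₀` of the remaining equations under `τ` gives
`σ₀ ∘ τ`, since every solution of the full system absorbs `τ` up to `≈` and so solves the smaller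
one. -/
theorem exists_isPrincipal_of_eliminate {X : S.Var} {π : Perm S} {t : Term S}
    {L : List (Term S × Term S)} {F : List (S.Atom × Term S)} {τ : Subst S}
    (hX : X ∉ t.vars) (hτX : τ.map X = t.perm π.reverse)
    (hτ : ∀ Y, Y ≠ X → τ.map Y = .susp [] Y)
    (h : ∃ c₀, IsPrincipal (solutions (L.map (Prod.map τ.apply τ.apply))
      (F.map (Prod.map _root_.id τ.apply))) c₀)
    (hinst : ∀ c ∈ solutions ((.susp π X, t) :: L) F,
      ∀ u, AlphaEq c.env (c.sub.apply (τ.apply u)) (c.sub.apply u)) :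
    ∃ c₀, IsPrincipal (solutions ((.susp π X, t) :: L) F) c₀ := by
  obtain ⟨c₀, ⟨hL, hF⟩, hc₀⟩ := h
  refine ⟨⟨c₀.env, c₀.sub.comp τ⟩, ⟨?_, ?_⟩, fun c hc => ?_⟩
  · refine List.forall_mem_cons.2 ⟨?_, fun p hp => ?_⟩
    · simp only [Subst.comp_apply]
      have h1 : τ.apply t = t := (Term.subst_congr fun Y hY => hτ Y
        (by rintro rfl; exact hX hY)).trans (Term.subst_id t)
      rw [h1]
      change AlphaEq _ (Term.subst _ ((τ.map X).perm π)) _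
      rw [hτX, Term.subst_perm, Term.subst_perm]
      exact alphaEq_reverse_perm π _
    · simp only [Subst.comp_apply]
      exact hL _ (List.mem_map_of_mem hp)
  · intro q hq
    simp only [Subst.comp_apply]
    exact hF _ (List.mem_map_of_mem hq)
  · have hi := hinst c hc
    obtain ⟨hE, hσ⟩ := hc₀ c (by
      refine ⟨fun p hp => ?_, fun q hq => ?_⟩
      · obtain ⟨p, hp', rfl⟩ := List.mem_map.1 hp
        exact (hi p.1).trans ((hc.1 p (List.mem_cons_of_mem _ hp')).trans (hi p.2).symm)
      · obtain ⟨q, hq', rfl⟩ := List.mem_map.1 hq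
        exact (hi q.2).symm.fresh (hc.2 q hq'))
    refine ⟨hE, fun Y => ?_⟩
    change AlphaEq _ (c.sub.apply (c₀.sub.apply (τ.map Y))) _
    have h1 : AlphaEq c.env (c.sub.apply (c₀.sub.apply (τ.map Y))) (c.sub.apply (τ.map Y)) := by
      rw [Subst.apply, Subst.apply, Term.subst_subst]
      exact alphaEq_subst_of_forall hσ _
    have h2 := hi (.susp [] Y)
    simp only [Subst.apply, Term.subst, Term.perm_nil] at h2
    exact h1.trans h2

/-- The total size of the instances of a list of equality equations. -/
noncomputable def instanceSize (σ : Subst S) (L : List (Term S × Term S)) : ℕ :=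
  (L.map fun p => (σ.apply p.1).size + (σ.apply p.2).size).sum

theorem instanceSize_cons (σ : Subst S) (t u : Term S) (L : List (Term S × Term S)) :
    instanceSize σ ((t, u) :: L) =
      (σ.apply t).size + (σ.apply u).size + instanceSize σ L := by
  simp [instanceSize]

theorem instanceSize_append (σ : Subst S) (L L' : List (Term S × Term S)) :
    instanceSize σ (L ++ L') = instanceSize σ L + instanceSize σ L' := by
  simp [instanceSize]

/-- Equality equations between terms of the same sort. -/
def EqsWellSorted (L : List (Term S × Term S)) : Prop :=
  ∀ p ∈ L, ∃ τ, HasSort p.1 τ ∧ HasSort p.2 τ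

theorem solutions_swap (t u : Term S) (L : List (Term S × Term S)) (F : List (S.Atom × Term S)) :
    solutions ((t, u) :: L) F = solutions ((u, t) :: L) F := by
  ext c
  simp only [solutions, Set.mem_ofPred_eq, List.forall_mem_cons]
  exact and_congr_left' (and_congr_left' ⟨.symm, .symm⟩)

/-- The existence of principal solutions for all systems that have a solution with smaller
instances of its equality equations. -/
def SolvableBelow (S : Signature.{u}) (n : ℕ) : Prop :=
  ∀ (L : List (Term S × Term S)) (F : List (S.Atom × Term S)), EqsWellSorted L →
    ∀ c ∈ solutions L F, instanceSize c.sub L < n → ∃ c₀, IsPrincipal (solutions L F) c₀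

theorem exists_isPrincipal_susp {n : ℕ} (ih : SolvableBelow S n) {π : Perm S} {X : S.Var}
    {u : Term S} {L : List (Term S × Term S)} {F : List (S.Atom × Term S)}
    (hL : EqsWellSorted ((.susp π X, u) :: L)) {c : Candidate S}
    (hc : c ∈ solutions ((.susp π X, u) :: L) F)
    (hn : instanceSize c.sub ((.susp π X, u) :: L) ≤ n) :
    ∃ c₀, IsPrincipal (solutions ((.susp π X, u) :: L) F) c₀ := by
  rw [instanceSize_cons] at hn
  have hpos := Term.size_pos (c.sub.apply u)
  have hL' : EqsWellSorted L := fun p hp => hL p (List.mem_cons_of_mem _ hp)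
  by_cases hu : ∃ π', u = .susp π' X
  · obtain ⟨π', rfl⟩ := hu
    obtain ⟨l, hl⟩ := π.exists_disagreement π'
    -- Whatever `X` becomes, the equation says that the atoms on which `π` and `π'` disagree are
    -- fresh for it.
    have hsol : solutions ((.susp π X, .susp π' X) :: L) F =
        solutions L ((l.map fun a => (a, .susp [] X)) ++ F) := by
      ext c
      simp only [solutions, Set.mem_ofPred_eq, List.forall_mem_cons, List.forall_mem_append,
        List.forall_mem_map, hl]
      simp only [Subst.apply, Term.subst, Term.perm_nil, alphaEq_perm_perm_iff]
      tauto
    rw [hsol] at hc ⊢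
    exact ih _ _ hL' c hc (by omega)
  · have hX : X ∉ u.vars := by
      intro hX
      have h1 := Term.size_lt_size_subst c.sub.map hX fun π' he => hu ⟨π', he⟩
      have h2 := (hc.1 _ List.mem_cons_self).size_eq
      simp only [Subst.apply] at h2
      rw [Term.subst, Term.size_perm] at h2
      omega
    obtain ⟨s, hs, hus⟩ := hL _ List.mem_cons_self
    have hs' : π.WellSorted ∧ s = S.sortOfVar X := by
      cases hs with
      | susp _ _ h => exact ⟨h, rfl⟩
    rw [hs'.2] at hus
    have hsort := HasSort.perm hus (Perm.WellSorted.reverse hs'.1)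
    have hτX : (Subst.single X _ hsort).map X = u.perm π.reverse := if_pos rfl
    have hτ : ∀ Y, Y ≠ X → (Subst.single X _ hsort).map Y = .susp [] Y := fun Y hY => if_neg hY
    generalize Subst.single X _ hsort = τ at hτX hτ
    have hinst : ∀ c ∈ solutions ((.susp π X, u) :: L) F,
        ∀ v, AlphaEq c.env (c.sub.apply (τ.apply v)) (c.sub.apply v) := by
      intro c hc v
      rw [Subst.apply, Subst.apply, Term.subst_subst]
      refine alphaEq_subst_of_forall (fun Y => ?_) v
      by_cases hY : Y = X
      · rw [hY, hτX, Term.subst_perm]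
        exact ((hc.1 _ List.mem_cons_self).symm.perm _).trans (alphaEq_perm_reverse π _)
      · rw [hτ Y hY, Term.subst, Term.perm_nil]
        exact .refl _
    refine exists_isPrincipal_of_eliminate hX hτX hτ ?_ hinst
    have hi := hinst c hc
    refine ih _ _ ?_ c ⟨fun p hp => ?_, fun q hq => ?_⟩ ?_
    · intro p hp
      obtain ⟨p, hp', rfl⟩ := List.mem_map.1 hp
      obtain ⟨s, h1, h2⟩ := hL' p hp'
      exact ⟨s, h1.subst τ.hasSort, h2.subst τ.hasSort⟩
    · obtain ⟨p, hp', rfl⟩ := List.mem_map.1 hp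
      exact (hi p.1).trans ((hc.1 p (List.mem_cons_of_mem _ hp')).trans (hi p.2).symm)
    · obtain ⟨q, hq', rfl⟩ := List.mem_map.1 hq
      exact (hi q.2).symm.fresh (hc.2 q hq')
    -- Elimination may enlarge the equations but not their instances under `c`; dropping the head
    -- equation makes the measure decrease.
    · have : instanceSize c.sub (L.map (Prod.map τ.apply τ.apply)) = instanceSize c.sub L := by
        simp [instanceSize, Function.comp_def, (hi _).size_eq]
      omega

theorem exists_isPrincipal_app {n : ℕ} (ih : SolvableBelow S n) {f : S.Fn}
    {ts us : Fin (S.arity f) → Term S} {L : List (Term S × Term S)} {F : List (S.Atom × Term S)}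
    (hL : EqsWellSorted ((.app f ts, .app f us) :: L)) {c : Candidate S}
    (hc : c ∈ solutions ((.app f ts, .app f us) :: L) F)
    (hn : instanceSize c.sub ((.app f ts, .app f us) :: L) ≤ n) :
    ∃ c₀, IsPrincipal (solutions ((.app f ts, .app f us) :: L) F) c₀ := by
  have hsol : solutions ((.app f ts, .app f us) :: L) F =
      solutions (List.ofFn (fun i => (ts i, us i)) ++ L) F := by
    ext c
    simp only [solutions, Set.mem_ofPred_eq, List.forall_mem_cons, List.forall_mem_append,
      List.forall_mem_ofFn_iff, Subst.apply, Term.subst, alphaEq_app_iff]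
  rw [hsol] at hc ⊢
  refine ih _ _ (List.forall_mem_append.2 ⟨?_, fun p hp => hL p (List.mem_cons_of_mem _ hp)⟩)
    c hc ?_
  · obtain ⟨s, h1, h2⟩ := hL _ List.mem_cons_self
    refine List.forall_mem_ofFn_iff.2 fun i => ⟨S.dom f i, ?_, ?_⟩
    · cases h1 with
      | app _ _ h => exact h i
    · cases h2 with
      | app _ _ h => exact h i
  · have h1 : instanceSize c.sub (List.ofFn fun i => (ts i, us i)) =
        ∑ i, (c.sub.apply (ts i)).size + ∑ i, (c.sub.apply (us i)).size := by
      rw [instanceSize, List.map_ofFn, List.sum_ofFn, ← Finset.sum_add_distrib]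
      rfl
    rw [instanceSize_append, h1]
    rw [instanceSize_cons] at hn
    simp only [Subst.apply, Term.subst, Term.size] at hn ⊢
    omega

theorem exists_isPrincipal_abs {n : ℕ} (ih : SolvableBelow S n) {a b : S.Atom}
    {t u : Term S} {L : List (Term S × Term S)} {F : List (S.Atom × Term S)}
    (hL : EqsWellSorted ((.abs a t, .abs b u) :: L)) {c : Candidate S}
    (hc : c ∈ solutions ((.abs a t, .abs b u) :: L) F)
    (hn : instanceSize c.sub ((.abs a t, .abs b u) :: L) ≤ n) :
    ∃ c₀, IsPrincipal (solutions ((.abs a t, .abs b u) :: L) F) c₀ := by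
  obtain ⟨s, h1, h2⟩ := hL _ List.mem_cons_self
  have hL' : EqsWellSorted L := fun p hp => hL p (List.mem_cons_of_mem _ hp)
  have hs : S.atomSort a = S.atomSort b ∧ ∃ s, HasSort t s ∧ HasSort u s := by
    cases h1 with
    | abs _ _ s h1 =>
      -- With the sort a variable, `cases` need not unify `S.atomSort a` with `S.atomSort b`.
      generalize hs' : NSort.abs (S.atomSort a) s = s' at h2
      cases h2 with
      | abs _ _ s'' h2 =>
        injection hs' with e1 e2
        subst e2
        exact ⟨e1, _, h1, h2⟩
  obtain ⟨hab, s, ht, hu⟩ := hs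
  rw [instanceSize_cons] at hn
  by_cases he : a = b
  · subst he
    have hsol : solutions ((.abs a t, .abs a u) :: L) F = solutions ((t, u) :: L) F := by
      ext c
      simp only [solutions, Set.mem_ofPred_eq, List.forall_mem_cons, Subst.apply, Term.subst,
        alphaEq_abs_same_iff]
    rw [hsol] at hc ⊢
    refine ih _ _ (List.forall_mem_cons.2 ⟨⟨s, ht, hu⟩, hL'⟩) c hc ?_
    rw [instanceSize_cons]
    simp only [Subst.apply, Term.subst, Term.size] at hn ⊢
    omega
  · have hsol : solutions ((.abs a t, .abs b u) :: L) F =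
        solutions ((t, u.perm [(a, b)]) :: L) ((a, u) :: F) := by
      ext c
      simp only [solutions, Set.mem_ofPred_eq, List.forall_mem_cons, Subst.apply, Term.subst,
        Term.subst_perm, alphaEq_abs_diff_iff he]
      tauto
    rw [hsol] at hc ⊢
    refine ih _ _ (List.forall_mem_cons.2 ⟨⟨s, ht, hu.perm ?_⟩, hL'⟩) c hc ?_
    · intro p hp
      rw [List.mem_singleton.1 hp]
      exact hab
    rw [instanceSize_cons]
    simp only [Subst.apply, Term.subst, Term.subst_perm, Term.size_perm, Term.size] at hn ⊢
    omega

theorem exists_isPrincipal_atom {n : ℕ} (ih : SolvableBelow S n) {a : S.Atom}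
    {L : List (Term S × Term S)} {F : List (S.Atom × Term S)}
    (hL : EqsWellSorted ((.atom a, .atom a) :: L)) {c : Candidate S}
    (hc : c ∈ solutions ((.atom a, .atom a) :: L) F)
    (hn : instanceSize c.sub ((.atom a, .atom a) :: L) ≤ n) :
    ∃ c₀, IsPrincipal (solutions ((.atom a, .atom a) :: L) F) c₀ := by
  have hsol : solutions ((.atom a, .atom a) :: L) F = solutions L F := by
    ext c
    simp only [solutions, Set.mem_ofPred_eq, List.forall_mem_cons, AlphaEq.refl, true_and]
  rw [hsol] at hc ⊢
  refine ih _ _ (fun p hp => hL p (List.mem_cons_of_mem _ hp)) c hc ?_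
  rw [instanceSize_cons] at hn
  have := Term.size_pos (c.sub.apply (.atom a))
  omega

/-- One step of the algorithm on the head equation. Distinct head constructors other than
suspensions are impossible, because substitution preserves them and `c` solves the equation. -/
theorem solvableBelow (S : Signature.{u}) (n : ℕ) : SolvableBelow S n := by
  induction n with
  | zero => exact fun L F _ c _ h => absurd h (Nat.not_lt_zero _)
  | succ n ih =>
    rintro (_ | ⟨⟨t, u⟩, L⟩) F hL c hc hn
    · exact exists_isPrincipal_nil F ⟨c, hc⟩
    · have hn := Nat.le_of_lt_succ hn
      have htu := hc.1 _ List.mem_cons_self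
      cases t with
      | susp π X => exact exists_isPrincipal_susp ih hL hc hn
      | app f ts =>
        cases u with
        | susp π X =>
          rw [solutions_swap] at hc ⊢
          rw [instanceSize_cons, Nat.add_comm (Term.size _), ← instanceSize_cons] at hn
          obtain ⟨⟨s, h1, h2⟩, h3⟩ := List.forall_mem_cons.1 hL
          exact exists_isPrincipal_susp ih (List.forall_mem_cons.2 ⟨⟨s, h2, h1⟩, h3⟩) hc hn
        | app g us =>
          obtain rfl : f = g := by
            simp only [Subst.apply, Term.subst] at htu
            cases htu
            rfl
          exact exists_isPrincipal_app ih hL hc hn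
        | atom b => nomatch htu
        | abs b u => nomatch htu
      | atom a =>
        cases u with
        | susp π X =>
          rw [solutions_swap] at hc ⊢
          rw [instanceSize_cons, Nat.add_comm (Term.size _), ← instanceSize_cons] at hn
          obtain ⟨⟨s, h1, h2⟩, h3⟩ := List.forall_mem_cons.1 hL
          exact exists_isPrincipal_susp ih (List.forall_mem_cons.2 ⟨⟨s, h2, h1⟩, h3⟩) hc hn
        | app g us => nomatch htu
        | atom b =>
          obtain rfl : a = b := by
            simp only [Subst.apply, Term.subst] at htu
            cases htu
            rfl
          exact exists_isPrincipal_atom ih hL hc hn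
        | abs b u => nomatch htu
      | abs a t =>
        cases u with
        | susp π X =>
          rw [solutions_swap] at hc ⊢
          rw [instanceSize_cons, Nat.add_comm (Term.size _), ← instanceSize_cons] at hn
          obtain ⟨⟨s, h1, h2⟩, h3⟩ := List.forall_mem_cons.1 hL
          exact exists_isPrincipal_susp ih (List.forall_mem_cons.2 ⟨⟨s, h2, h1⟩, h3⟩) hc hn
        | app g us => nomatch htu
        | atom b => nomatch htu
        | abs b u => exact exists_isPrincipal_abs ih hL hc hn

/-! ### Unification problems -/

theorem Problem.exists_solutions_eq (P : Problem S) :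
    ∃ L F, EqsWellSorted L ∧ P.unifiers = solutions L F := by
  have key : ∀ l : List (Equation S), (∀ e ∈ l, e.WellSorted) →
      ∃ L F, EqsWellSorted L ∧ {c : Candidate S | ∀ e ∈ l, c.Satisfies e} = solutions L F := by
    intro l
    induction l with
    | nil => exact fun _ => ⟨[], [], by simp [EqsWellSorted], by simp [solutions]⟩
    | cons e l ih =>
      intro h
      obtain ⟨he, hl⟩ := List.forall_mem_cons.1 h
      obtain ⟨L, F, hL, hLF⟩ := ih hl
      have hmem := fun c => Set.ext_iff.1 hLF c
      cases e with
      | eq t u =>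
        refine ⟨(t, u) :: L, F, List.forall_mem_cons.2 ⟨he, hL⟩, ?_⟩
        ext c
        have := hmem c
        simp only [solutions, Set.mem_ofPred_eq, List.forall_mem_cons, Candidate.Satisfies] at this ⊢
        tauto
      | fresh a t =>
        refine ⟨L, (a, t) :: F, hL, ?_⟩
        ext c
        have := hmem c
        simp only [solutions, Set.mem_ofPred_eq, List.forall_mem_cons, Candidate.Satisfies] at this ⊢
        tauto
  obtain ⟨L, F, hL, h⟩ := key P.eqs.toList fun e he => P.wellSorted e (Finset.mem_toList.1 he)
  exact ⟨L, F, hL, by rw [← h]; simp [Problem.unifiers]⟩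

/-- A solvable nominal unification problem has a principal unifier. -/
theorem Problem.exists_isPrincipal (P : Problem S) (h : P.unifiers.Nonempty) :
    ∃ c₀, IsPrincipal P.unifiers c₀ := by
  obtain ⟨L, F, hL, hP⟩ := P.exists_solutions_eq
  rw [hP] at h ⊢
  obtain ⟨c, hc⟩ := h
  exact solvableBelow S _ L F hL c hc (Nat.lt_succ_self _)

/-! ### Comparing most general unifiers through a principal one -/

theorem Subst.restrict_map {σ : Subst S} {V : Finset S.Var} {X : S.Var} (h : X ∈ V) :
    (σ.restrict V).map X = σ.map X := if_pos h

theorem Candidate.moreGeneral_iff {c₁ c₂ : Candidate S} :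
    c₁.MoreGeneral c₂ ↔ ∃ σ : Subst S, EnvEntails c₂.env σ c₁.env ∧
      ∀ X, X ∈ c₁.sub.dom ∨ X ∈ c₂.sub.dom →
        AlphaEq c₂.env (σ.apply (c₁.sub.map X)) (c₂.sub.map X) := by
  classical
  refine exists_congr fun σ => and_congr_right fun _ => ?_
  have hd : ∀ X, X ∈ ((σ.comp c₁.sub).restrict (c₁.sub.dom ∪ c₂.sub.dom)).dom ∪ c₂.sub.dom ↔
      X ∈ c₁.sub.dom ∨ X ∈ c₂.sub.dom := fun X => by
    simp only [Subst.restrict, Finset.mem_union]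
    tauto
  have hm : ∀ X, X ∈ c₁.sub.dom ∨ X ∈ c₂.sub.dom →
      ((σ.comp c₁.sub).restrict (c₁.sub.dom ∪ c₂.sub.dom)).map X = σ.apply (c₁.sub.map X) :=
    fun X hX => Subst.restrict_map (Finset.mem_union.2 hX)
  constructor
  · intro h X hX
    rw [← hm X hX]
    convert h X (by convert (hd X).2 hX)
  · intro h X hX
    have hX' := (hd X).1 (by convert hX)
    convert h X hX' using 1
    rw [← hm X hX']

/-- If some candidate of which all members of `U` are instances stays in `U` when its domain is
changed to `V`, then a most general member is more general than each member, provided that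
both have their domains inside `V`. -/
theorem IsMostGeneral.moreGeneral {U : Set (Candidate S)} {c₀ c₁ c₂ : Candidate S}
    {V : Finset S.Var} (h₁ : IsMostGeneral U c₁)
    (hU : ⟨c₀.env, c₀.sub.restrict V⟩ ∈ U)
    (hprinc : ∀ c ∈ U, EnvEntails c.env c.sub c₀.env ∧
      ∀ X, AlphaEq c.env (c.sub.apply (c₀.sub.map X)) (c.sub.map X))
    (hd₁ : c₁.sub.dom ⊆ V) (hd₂ : c₂.sub.dom ⊆ V) (h₂ : c₂ ∈ U) : c₁.MoreGeneral c₂ := by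
  have h01 : Candidate.MoreGeneral ⟨c₀.env, c₀.sub.restrict V⟩ c₁ := by
    refine Candidate.moreGeneral_iff.2 ⟨c₁.sub, (hprinc c₁ h₁.1).1, fun X hX => ?_⟩
    have hX' : X ∈ V := hX.elim _root_.id fun h => hd₁ h
    simp only [Subst.restrict_map hX']
    exact (hprinc c₁ h₁.1).2 X
  obtain ⟨σ, hE, hσ⟩ := Candidate.moreGeneral_iff.1 (h₁.2 _ hU h01)
  obtain ⟨hE₂, hσ₂⟩ := hprinc c₂ h₂
  -- `σ` leads from `c₁` to the restricted principal candidate, and `c₂.sub` from there to `c₂`.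
  refine Candidate.moreGeneral_iff.2 ⟨c₂.sub.comp σ, fun p hp => (hE p hp).subst hE₂,
    fun X hX => ?_⟩
  have hX' : X ∈ V := hX.elim (fun h => hd₁ h) fun h => hd₂ h
  have h := (hσ X (.inr hX')).subst hE₂
  simp only [Subst.restrict_map hX'] at h
  rw [Subst.comp_apply]
  exact h.trans (hσ₂ X)

theorem Candidate.satisfies_congr {E : FreshEnv S} {σ τ : Subst S} {e : Equation S}
    (h : ∀ X ∈ e.vars, σ.map X = τ.map X) :
    Candidate.Satisfies ⟨E, σ⟩ e ↔ Candidate.Satisfies ⟨E, τ⟩ e := by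
  cases e with
  | eq t u =>
    simp only [Candidate.Satisfies, Subst.apply]
    rw [Term.subst_congr fun X hX => h X (.inl hX), Term.subst_congr fun X hX => h X (.inr hX)]
  | fresh a t =>
    simp only [Candidate.Satisfies, Subst.apply]
    rw [Term.subst_congr fun X hX => h X hX]

theorem Problem.restrict_mem_unifiers {P : Problem S} {c : Candidate S} (hc : c ∈ P.unifiers)
    {V : Finset S.Var} (hV : ∀ X ∈ P.vars, X ∈ c.sub.dom → X ∈ V) :
    ⟨c.env, c.sub.restrict V⟩ ∈ P.unifiers := by
  refine fun e he => (Candidate.satisfies_congr fun X hX => ?_).1 (hc e he)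
  by_cases hXV : X ∈ V
  · rw [Subst.restrict_map hXV]
  · rw [Subst.map_of_notMem (c.sub.restrict V) X hXV,
      c.sub.map_of_notMem X fun h => hXV (hV X ⟨e, he, hX⟩ h)]

end Nominal

theorem mainTheorem7 {S : Nominal.Signature.{u}} (P : Nominal.Problem S) :
    (∀ c₁ c₂ : Nominal.Candidate S,
      Nominal.IsMostGeneral P.unifiers c₁ → Nominal.IsMostGeneral P.unifiers c₂ →
        c₁.MoreGeneral c₂ ∧ c₂.MoreGeneral c₁) ∧
    (∀ c₁ c₂ : Nominal.Candidate S,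
      Nominal.IsMostGeneral {c ∈ P.unifiers | (c.sub.dom : Set S.Var) = P.vars} c₁ →
      Nominal.IsMostGeneral {c ∈ P.unifiers | (c.sub.dom : Set S.Var) = P.vars} c₂ →
        c₁.MoreGeneral c₂ ∧ c₂.MoreGeneral c₁) := by
  classical
  refine ⟨fun c₁ c₂ h₁ h₂ => ?_, fun c₁ c₂ h₁ h₂ => ?_⟩
  · obtain ⟨c₀, hc₀, hprinc⟩ := P.exists_isPrincipal ⟨c₁, h₁.1⟩
    have hU := Nominal.Problem.restrict_mem_unifiers hc₀
      -- Including the domain of `c₀` keeps its restriction a unifier; including the other two makes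
      -- the comparisons cover all their variables.
      (V := c₀.sub.dom ∪ (c₁.sub.dom ∪ c₂.sub.dom)) fun X _ hX => Finset.mem_union_left _ hX
    have hd₁ : c₁.sub.dom ⊆ c₀.sub.dom ∪ (c₁.sub.dom ∪ c₂.sub.dom) :=
      Finset.subset_union_left.trans Finset.subset_union_right
    have hd₂ : c₂.sub.dom ⊆ c₀.sub.dom ∪ (c₁.sub.dom ∪ c₂.sub.dom) :=
      Finset.subset_union_right.trans Finset.subset_union_right
    exact ⟨h₁.moreGeneral hU hprinc hd₁ hd₂ h₂.1, h₂.moreGeneral hU hprinc hd₂ hd₁ h₁.1⟩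
  · obtain ⟨c₀, hc₀, hprinc⟩ := P.exists_isPrincipal ⟨c₁, h₁.1.1⟩
    have hV : ∀ X ∈ P.vars, X ∈ c₁.sub.dom := fun X hX =>
      Finset.mem_coe.1 (h₁.1.2.symm ▸ hX)
    -- As a set this `V` is the set of variables of `P`, so the restriction lies in the smaller
    -- class even if `c₀` does not.
    have hU := Nominal.Problem.restrict_mem_unifiers hc₀ (V := c₁.sub.dom) fun X hX _ => hV X hX
    have hd : c₂.sub.dom = c₁.sub.dom := Finset.coe_injective (h₂.1.2.trans h₁.1.2.symm)
    have hp := fun c (hc : c ∈ {c ∈ P.unifiers | (c.sub.dom : Set S.Var) = P.vars}) =>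
      hprinc c hc.1
    exact ⟨h₁.moreGeneral ⟨hU, h₁.1.2⟩ hp subset_rfl hd.subset h₂.1,
      h₂.moreGeneral ⟨hU, h₁.1.2⟩ hp hd.subset subset_rfl h₁.1⟩
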